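/- Let $n \ge 3$. For a prime $p$ identify $\mathbb{F}_p$ with $\{0,1,\dots,p-1\}$, and for $A=(a_{ij})\in \mathrm{SL}_n(\mathbb{F}_p)$ with inverse $A^{-1}=(b_{ij})$ let $g_p(A)\in[0,1]^{2n^2}$ be the point with coordinates $a_{ij}/p$ and $b_{ij}/p$ $(1\le i,j\le n)$. Let $R\subseteq[0,1]^{2n^2}$ be a (Lebesgue) measurable set such that for every $\epsilon>0$ there are two finite collections of non-overlapping rectangles $R_1,\dots,R_k$ and $R^1,\dots,R^l$ with $$\bigcup_{i=1}^k R_i\subseteq R\subseteq\bigcup_{j=1}^l R^j,\qquad \mathrm{area}\Big(R\setminus\bigcup_{i=1}^k R_i\Big)<\epsilon,\qquad \mathrm{area}\Big(\bigcup_{j=1}^l R^j\setminus R\Big)<\epsilon .$$ Here a rectangle is a product of $2n^2$ bounded intervals, each with or without its endpoints; non-overlapping means that the interiors are pairwise disjoint; and area is Lebesgue measure on $\mathbb{R}^{2n^2}$. Then, as $p$ runs over the primes, $$\lim_{p\to\infty}\frac{\#\big(g_p(\mathrm{SL}_n(\mathbb{F}_p))\cap R\big)}{\#\mathrm{SL}_n(\mathbb{F}_p)}=\mathrm{area}(R).$$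 -/

import Mathlib

open Filter Topology MeasureTheory

/-- The index set of the `2n²` coordinates, arranged as an `n × 2n` array: in each row, the first
`n` columns belong to `A` and the last `n` columns to `A⁻¹`. -/
abbrev PairIndex (n : ℕ) : Type := Fin n × (Fin n ⊕ Fin n)

/-- The map `g_p` restricted to `SL_n(𝔽_p)`: the matrix `A = (a_ij)` with inverse `A⁻¹ = (b_ij)`
is sent to the point of `[0,1]^{2n²}` with coordinates `a_ij / p` and `b_ij / p`, where the
representatives of residue classes are taken in `{0, …, p - 1}`. -/
noncomputable def slPoint (n p : ℕ) (A : Matrix.SpecialLinearGroup (Fin n) (ZMod p)) :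
    PairIndex n → ℝ
  | (i, Sum.inl j) => (ZMod.val ((A : Matrix (Fin n) (Fin n) (ZMod p)) i j) : ℝ) / p
  | (i, Sum.inr j) =>
      (ZMod.val (((A⁻¹ : Matrix.SpecialLinearGroup (Fin n) (ZMod p)) :
        Matrix (Fin n) (Fin n) (ZMod p)) i j) : ℝ) / p

/-- A rectangle with sides parallel to the axes: a product of bounded intervals. Each interval may
or may not contain its endpoints (the order-connected subsets of `ℝ` are the intervals). -/
def IsRectangle {ι : Type*} (B : Set (ι → ℝ)) : Prop :=
  ∃ I : ι → Set ℝ, (∀ i, (I i).OrdConnected ∧ Bornology.IsBounded (I i)) ∧ B = Set.univ.pi I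

/-- A finite collection of non-overlapping rectangles: their interiors are pairwise disjoint. -/
def IsNonoverlappingRectangles {ι : Type*} {k : ℕ} (B : Fin k → Set (ι → ℝ)) : Prop :=
  (∀ i, IsRectangle (B i)) ∧ Pairwise fun i j => Disjoint (interior (B i)) (interior (B j))

/-- For every `ε > 0` the set `R` lies between two finite unions of non-overlapping rectangles,
each of which differs from `R` by a set of volume less than `ε`. -/
def HasRectangleApproximation {ι : Type*} [Fintype ι] (R : Set (ι → ℝ)) : Prop :=
  ∀ ε : ℝ, 0 < ε →
    ∃ (k l : ℕ) (B : Fin k → Set (ι → ℝ)) (C : Fin l → Set (ι → ℝ)),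
      IsNonoverlappingRectangles B ∧ IsNonoverlappingRectangles C ∧
      (⋃ i, B i) ⊆ R ∧ R ⊆ (⋃ j, C j) ∧
      volume (R \ ⋃ i, B i) < ENNReal.ofReal ε ∧ volume ((⋃ j, C j) \ R) < ENNReal.ofReal ε

/-! By Weyl's criterion it suffices that, for each nonzero integer frequency, the mean over `A` of
the corresponding character of `slPoint n p A` tends to 0. That mean is a matrix Kloosterman sum
with phase `tr (U A) + tr (V A⁻¹)`, where `(U, V) ≠ 0` mod `p` once `p` is large. Replacing `A` by
`A (1 + t E_ij)` changes the phase by `t` times a slope `d A`, so averaging over `t` leaves only the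
`A` with `d A = 0`. A second transvection, through a third index, makes `d` itself affine in `t`,
which bounds the proportion of such `A` by `(n + 1) / p` (`norm_sum_addChar_trace_mul_card_le`).
Weak convergence then follows (`tendsto_cubeMeasure`), and it yields convergence on `R` because
rectangle approximation forces a null boundary (`HasRectangleApproximation.volume_frontier`). -/

/-! ### Averaging over translates in a finite group -/

/-- A function on a finite group that is affine in `t` along the translates `A * u t`, with a
slope that does not depend on `t`, rarely vanishes together with a nonvanishing slope. -/
theorem card_filter_eq_zero_and_ne_zero_mul_card_le {G F : Type*} [Group G] [Fintype G] [Field F]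
    [Fintype F] [DecidableEq F] (u : F → G) (d e : G → F)
    (hd : ∀ A t, d (A * u t) = d A + t * e A) (he : ∀ A t, e (A * u t) = e A) :
    (Finset.univ.filter fun A => d A = 0 ∧ e A ≠ 0).card * Fintype.card F ≤ Fintype.card G := by
  classical
  have h1 : ∀ t, (Finset.univ.filter fun A => d A = 0 ∧ e A ≠ 0).card =
      ∑ A, if d A + t * e A = 0 ∧ e A ≠ 0 then 1 else 0 := fun t => by
    rw [Finset.card_filter, ← Equiv.sum_comp (Equiv.mulRight (u t))]
    simp only [Equiv.coe_mulRight, hd, he]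
  calc _ = ∑ t : F, (Finset.univ.filter fun A => d A = 0 ∧ e A ≠ 0).card := by
        simp [mul_comm]
    _ = ∑ A, ∑ t, if d A + t * e A = 0 ∧ e A ≠ 0 then 1 else 0 := by
        rw [Finset.sum_congr rfl fun t _ => h1 t, Finset.sum_comm]
    _ ≤ ∑ A : G, 1 := by
        -- An affine function of `t` with nonzero slope has at most one root.
        refine Finset.sum_le_sum fun A _ => ?_
        rw [← Finset.card_filter, Finset.card_le_one]
        intro s hs t ht
        simp only [Finset.mem_filter, Finset.mem_univ, true_and] at hs ht
        exact mul_right_cancel₀ hs.2 (add_left_cancel (hs.1.trans ht.1.symm))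
    _ = _ := by simp

/-- Averaging a character sum over the translates `A * u t` bounds it by the number of elements
at which the phase is stationary. -/
theorem norm_sum_addChar_le_card {G F : Type*} [Group G] [Fintype G] [Field F]
    [Fintype F] [DecidableEq F] {ψ : AddChar F ℂ} (hψ : ψ.IsPrimitive) (u : F → G) (c d : G → F)
    (hc : ∀ A t, c (A * u t) = c A + t * d A) :
    ‖∑ A, ψ (c A)‖ ≤ (Finset.univ.filter fun A => d A = 0).card := by
  have key : (Fintype.card F : ℂ) * ∑ A, ψ (c A) =
      Fintype.card F * ∑ A ∈ Finset.univ.filter fun A => d A = 0, ψ (c A) := by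
    calc _ = ∑ t : F, ∑ A, ψ (c A) := by simp
      _ = ∑ t : F, ∑ A, ψ (c A) * ψ (t * d A) := by
        refine Finset.sum_congr rfl fun t _ => ?_
        rw [← Equiv.sum_comp (Equiv.mulRight (u t))]
        simp only [Equiv.coe_mulRight, hc, AddChar.map_add_eq_mul]
      _ = ∑ A, ψ (c A) * ∑ t, ψ (t * d A) := by
        rw [Finset.sum_comm]; simp only [Finset.mul_sum]
      _ = _ := by
        -- Orthogonality: the inner sum is `card F` if `d A = 0` and 0 otherwise.
        simp only [AddChar.sum_mulShift _ hψ, Finset.sum_filter, Finset.mul_sum]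
        refine Finset.sum_congr rfl fun A _ => ?_
        split_ifs <;> simp [mul_comm]
  rw [mul_left_cancel₀ (by simp [Fintype.card_ne_zero]) key]
  refine (norm_sum_le _ _).trans ?_
  simp

/-! ### Kloosterman sums over `SL_n` -/

namespace Matrix.SpecialLinearGroup

variable {n F : Type*} [Fintype n] [DecidableEq n] [Field F]

theorem vecMul_mul_transvection_apply_same (x : n → F) (A : SpecialLinearGroup n F) {i j : n}
    (hij : i ≠ j) (t : F) :
    (x ᵥ* (A * transvection hij t : SpecialLinearGroup n F).1) j =
      (x ᵥ* A.1) j + t * (x ᵥ* A.1) i := by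
  change (x ᵥ* (A.1 * Matrix.transvection i j t)) j = _
  simp only [vecMul, dotProduct, mul_transvection_apply_same, mul_add, Finset.sum_add_distrib,
    Finset.mul_sum, mul_left_comm]

theorem vecMul_mul_transvection_apply_of_ne (x : n → F) (A : SpecialLinearGroup n F) {i j k : n}
    (hij : i ≠ j) (hk : k ≠ j) (t : F) :
    (x ᵥ* (A * transvection hij t : SpecialLinearGroup n F).1) k = (x ᵥ* A.1) k := by
  change (x ᵥ* (A.1 * Matrix.transvection i j t)) k = _
  simp only [vecMul, dotProduct, mul_transvection_apply_of_ne _ _ _ _ hk]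

theorem inv_mul_transvection_mulVec_apply_of_ne (y : n → F) (A : SpecialLinearGroup n F)
    {i j k : n} (hij : i ≠ j) (hk : k ≠ i) (t : F) :
    ((A * transvection hij t)⁻¹.1 *ᵥ y) k = (A⁻¹.1 *ᵥ y) k := by
  rw [_root_.mul_inv_rev, transvection_inv]
  change ((Matrix.transvection i j (-t) * A⁻¹.1) *ᵥ y) k = _
  simp only [mulVec, dotProduct, transvection_mul_apply_of_ne _ _ _ _ hk]

theorem trace_mul_transvection (U : Matrix n n F) (A : SpecialLinearGroup n F) {i j : n}
    (hij : i ≠ j) (t : F) :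
    (U * (A * transvection hij t : SpecialLinearGroup n F).1).trace =
      (U * A.1).trace + t * (U j ᵥ* A.1) i := by
  rw [coe_mul, transvection_coe, mul_add, mul_add, mul_one, trace_add, ← mul_assoc,
    trace_mul_single]
  simp [mul_comm t, Matrix.mul_apply, vecMul, dotProduct]

theorem trace_mul_inv_mul_transvection (V : Matrix n n F) (A : SpecialLinearGroup n F) {i j : n}
    (hij : i ≠ j) (t : F) :
    (V * (A * transvection hij t)⁻¹.1).trace =
      (V * A⁻¹.1).trace - t * (A⁻¹.1 *ᵥ V.col i) j := by
  rw [_root_.mul_inv_rev, transvection_inv, coe_mul, transvection_coe, add_mul, mul_add, one_mul,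
    trace_add, trace_mul_comm V (_ * _), mul_assoc, trace_single_mul]
  simp [Matrix.mul_apply, mulVec, dotProduct, sub_eq_add_neg]

variable [Fintype F] [DecidableEq F]

/-- As `A` is invertible, `x ᵥ* A` has a nonzero entry, at some `l ≠ k`. Adding `t` times column `l`
to column `k` moves entry `k` with slope entry `l`; summing over `l` gives the factor `card n`. -/
theorem card_filter_vecMul_apply_eq_zero_mul_card_le {x : n → F} (hx : x ≠ 0) (k : n) :
    (Finset.univ.filter fun A : SpecialLinearGroup n F => (x ᵥ* A.1) k = 0).card * Fintype.card F ≤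
      Fintype.card n * Fintype.card (SpecialLinearGroup n F) := by
  have hsub : (Finset.univ.filter fun A : SpecialLinearGroup n F => (x ᵥ* A.1) k = 0) ⊆
      Finset.univ.biUnion fun l => Finset.univ.filter fun A : SpecialLinearGroup n F =>
        (x ᵥ* A.1) k = 0 ∧ (x ᵥ* A.1) l ≠ 0 := by
    intro A hA
    simp only [Finset.mem_filter, Finset.mem_univ, true_and, Finset.mem_biUnion] at hA ⊢
    have : x ᵥ* A.1 ≠ 0 := fun h => hx <| by
      have := congr_arg (· ᵥ* A⁻¹.1) h
      rwa [vecMul_vecMul, ← coe_mul, mul_inv_cancel, coe_one, vecMul_one, zero_vecMul] at this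
    obtain ⟨l, hl⟩ := Function.ne_iff.1 this
    exact ⟨l, hA, hl⟩
  calc _ ≤ (∑ l, (Finset.univ.filter fun A : SpecialLinearGroup n F =>
        (x ᵥ* A.1) k = 0 ∧ (x ᵥ* A.1) l ≠ 0).card) * Fintype.card F :=
        Nat.mul_le_mul_right _ ((Finset.card_le_card hsub).trans Finset.card_biUnion_le)
    _ ≤ ∑ l : n, Fintype.card (SpecialLinearGroup n F) := by
        rw [Finset.sum_mul]
        refine Finset.sum_le_sum fun l _ => ?_
        rcases eq_or_ne l k with rfl | hlk
        · simp [and_not_self]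
        · exact card_filter_eq_zero_and_ne_zero_mul_card_le (transvection hlk) _ _
            (fun A t => vecMul_mul_transvection_apply_same x A hlk t)
            fun A t => vecMul_mul_transvection_apply_of_ne x A hlk hlk t
    _ = _ := by simp

theorem norm_sum_addChar_trace_mul_card_le_of_left_ne_zero (hn : 3 ≤ Fintype.card n)
    {ψ : AddChar F ℂ} (hψ : ψ.IsPrimitive) {U : Matrix n n F} (V : Matrix n n F) (hU : U ≠ 0) :
    ‖∑ A : SpecialLinearGroup n F, ψ ((U * A.1).trace + (V * A⁻¹.1).trace)‖ * Fintype.card F ≤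
      (Fintype.card n + 1) * Fintype.card (SpecialLinearGroup n F) := by
  obtain ⟨j, hj⟩ := Function.ne_iff.1 hU
  -- Here `3 ≤ card n` supplies three distinct indices: row `j` of `U` is nonzero, the pair `(i, j)`
  -- carries the first transvection and `(k, i)` the second.
  obtain ⟨i, hi⟩ : ∃ i, i ∉ ({j} : Finset n) := by
    by_contra! h
    have := Finset.card_le_card (fun i _ => h i : Finset.univ ⊆ ({j} : Finset n))
    simp at this; omega
  obtain ⟨k, hk⟩ : ∃ k, k ∉ ({i, j} : Finset n) := by
    by_contra! h
    have := (Finset.card_le_card (fun i _ => h i : Finset.univ ⊆ ({i, j} : Finset n))).trans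
      Finset.card_le_two
    simp at this; omega
  simp only [Finset.mem_insert, Finset.mem_singleton, not_or] at hi hk
  set d : SpecialLinearGroup n F → F := fun A => (U j ᵥ* A.1) i - (A⁻¹.1 *ᵥ V.col i) j with hd
  have h1 := norm_sum_addChar_le_card hψ (transvection hi)
    (fun A => (U * A.1).trace + (V * A⁻¹.1).trace) d fun A t => by
      rw [trace_mul_transvection, trace_mul_inv_mul_transvection, hd]; ring
  -- The second transvection alters only column `i` of `A` and row `k` of `A⁻¹`. Since `k ≠ j`, the
  -- `V`-term of `d` is fixed, and the slope is entry `k` of `U j ᵥ* A`.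
  have h2 := card_filter_eq_zero_and_ne_zero_mul_card_le (transvection hk.1) d
    (fun A => (U j ᵥ* A.1) k) (fun A t => by
      simp only [hd]
      rw [vecMul_mul_transvection_apply_same,
        inv_mul_transvection_mulVec_apply_of_ne _ _ _ (Ne.symm hk.2)]; ring)
    fun A t => vecMul_mul_transvection_apply_of_ne _ _ _ hk.1 _
  have h3 := card_filter_vecMul_apply_eq_zero_mul_card_le hj k
  have h4 : (Finset.univ.filter fun A => d A = 0).card ≤
      (Finset.univ.filter fun A => d A = 0 ∧ (U j ᵥ* A.1) k ≠ 0).card +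
      (Finset.univ.filter fun A : SpecialLinearGroup n F => (U j ᵥ* A.1) k = 0).card := by
    rw [add_comm]
    refine (Finset.card_le_card fun A hA => ?_).trans (Finset.card_union_le _ _)
    simp only [Finset.mem_union, Finset.mem_filter, Finset.mem_univ, true_and] at hA ⊢
    tauto
  have h5 : (Finset.univ.filter fun A => d A = 0).card * Fintype.card F ≤
      (Fintype.card n + 1) * Fintype.card (SpecialLinearGroup n F) :=
    (Nat.mul_le_mul_right _ h4).trans (by rw [add_mul, add_mul]; omega)
  exact (mul_le_mul_of_nonneg_right h1 (by positivity)).trans (by exact_mod_cast h5)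

/-- The matrix Kloosterman sums over `SL_n` have a power saving when `n ≥ 3`. -/
theorem norm_sum_addChar_trace_mul_card_le (hn : 3 ≤ Fintype.card n)
    {ψ : AddChar F ℂ} (hψ : ψ.IsPrimitive) {U V : Matrix n n F} (h : U ≠ 0 ∨ V ≠ 0) :
    ‖∑ A : SpecialLinearGroup n F, ψ ((U * A.1).trace + (V * A⁻¹.1).trace)‖ * Fintype.card F ≤
      (Fintype.card n + 1) * Fintype.card (SpecialLinearGroup n F) := by
  rcases h with h | h
  · exact norm_sum_addChar_trace_mul_card_le_of_left_ne_zero hn hψ V h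
  -- The substitution `A ↦ A⁻¹` exchanges `U` and `V`.
  · rw [← Equiv.sum_comp (Equiv.inv _)]
    simp only [Equiv.inv_apply, inv_inv, add_comm (U * _).trace]
    exact norm_sum_addChar_trace_mul_card_le_of_left_ne_zero hn hψ U h

end Matrix.SpecialLinearGroup

/-! ### Weyl's criterion on the unit cube -/

namespace UnitAddTorus

variable {ι : Type*}

/-- The projection of `ℝ^ι` onto the torus. -/
def proj (x : ι → ℝ) : UnitAddTorus ι := fun i => (x i : UnitAddCircle)

theorem continuous_proj : Continuous (proj : (ι → ℝ) → UnitAddTorus ι) :=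
  continuous_pi fun i => (AddCircle.continuous_mk' 1).comp (continuous_apply i)

theorem isOpenMap_proj [Finite ι] : IsOpenMap (proj : (ι → ℝ) → UnitAddTorus ι) :=
  IsOpenMap.piMap (fun _ => QuotientAddGroup.isOpenMap_coe) (by simp)

/-- Points with the same image in the torus whose coordinates differ by less than `1` are equal. -/
theorem eq_of_proj_eq {x y : ι → ℝ} (h : proj x = proj y) (hxy : ∀ i, |x i - y i| < 1) :
    x = y := by
  ext i
  have hi : ((x i - y i : ℝ) : UnitAddCircle) = 0 := by
    rw [AddCircle.coe_sub, sub_eq_zero]; exact congr_fun h i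
  obtain ⟨m, hm⟩ := (AddCircle.coe_eq_zero_iff 1).1 hi
  have hm1 := hxy i
  rw [← hm, zsmul_one, ← Int.cast_abs, ← Int.cast_one, Int.cast_lt, Int.abs_lt_one_iff] at hm1
  rw [hm1, zero_smul] at hm
  linarith

variable [Fintype ι]

/-- Lebesgue measure on the half-open unit cube. -/
noncomputable def cubeMeasure (ι : Type*) [Fintype ι] : ProbabilityMeasure (ι → ℝ) :=
  ⟨Measure.pi fun _ => volume.restrict (Set.Ioc 0 1), ⟨by simp [Measure.pi_univ]⟩⟩

theorem coe_cubeMeasure : (cubeMeasure ι : Measure (ι → ℝ)) =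
    volume.restrict (Set.univ.pi fun _ => Set.Ioc 0 1) := by
  rw [volume_pi, Measure.restrict_pi_pi]; rfl

/-- The integral factors over coordinates, and a factor with `k i ≠ 0` integrates an exponential
over full periods. -/
theorem integral_mFourier_cubeMeasure {k : ι → ℤ} (hk : k ≠ 0) :
    ∫ x, mFourier k (proj x) ∂(cubeMeasure ι : Measure (ι → ℝ)) = 0 := by
  obtain ⟨i, hi⟩ := Function.ne_iff.1 hk
  have : ∀ x : ι → ℝ, mFourier k (proj x) = ∏ i, fourier (k i) (x i : UnitAddCircle) :=
    fun x => rfl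
  simp only [this]
  change ∫ x, _ ∂(Measure.pi fun _ : ι => (volume : Measure ℝ).restrict (Set.Ioc 0 1)) = 0
  rw [integral_fintype_prod_eq_prod (fun i (x : ℝ) => (fourier (k i) (x : UnitAddCircle) : ℂ))]
  refine Finset.prod_eq_zero (Finset.mem_univ i) ?_
  rw [← intervalIntegral.integral_of_le zero_le_one]
  have hc : 2 * Real.pi * Complex.I * k i ≠ 0 := by
    simpa [Real.pi_ne_zero] using hi
  have hx : ∀ x : ℝ, fourier (k i) (x : UnitAddCircle) =
      Complex.exp (2 * Real.pi * Complex.I * k i * x) := fun x => by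
    rw [fourier_coe_apply]; simp
  simp only [hx]
  rw [integral_exp_mul_complex hc]
  have := Complex.exp_int_mul_two_pi_mul_I (k i)
  rw [mul_comm] at this
  simp [this]

/-- Vanishing of the limits of all nontrivial Fourier coefficients implies convergence of the
integrals of all continuous functions on the torus. -/
theorem tendsto_integral_comp_proj {P : Type*} {l : Filter P}
    {μ : P → ProbabilityMeasure (ι → ℝ)}
    (h : ∀ k : ι → ℤ, k ≠ 0 →
      Tendsto (fun p => ∫ x, mFourier k (proj x) ∂(μ p : Measure (ι → ℝ))) l (𝓝 0))
    (f : C(UnitAddTorus ι, ℂ)) :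
    Tendsto (fun p => ∫ x, f (proj x) ∂(μ p : Measure (ι → ℝ))) l
      (𝓝 (∫ x, f (proj x) ∂(cubeMeasure ι : Measure (ι → ℝ)))) := by
  have hint : ∀ (f : C(UnitAddTorus ι, ℂ)) (ν : ProbabilityMeasure (ι → ℝ)),
      Integrable (fun x => f (proj x)) (ν : Measure (ι → ℝ)) := fun f ν =>
    Integrable.of_bound (f.continuous.comp continuous_proj).aestronglyMeasurable ‖f‖
      (ae_of_all _ fun x => f.norm_coe_le_norm _)
  have hspan : ∀ f ∈ Submodule.span ℂ (Set.range (mFourier (d := ι))),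
      Tendsto (fun p => ∫ x, f (proj x) ∂(μ p : Measure (ι → ℝ))) l
        (𝓝 (∫ x, f (proj x) ∂(cubeMeasure ι : Measure (ι → ℝ)))) := by
    intro f hf
    induction hf using Submodule.span_induction with
    | mem f hf =>
      obtain ⟨k, rfl⟩ := hf
      rcases eq_or_ne k 0 with rfl | hk
      · simpa [mFourier_zero] using tendsto_const_nhds
      · rw [integral_mFourier_cubeMeasure hk]; exact h k hk
    | zero => simpa using tendsto_const_nhds
    | add f g _ _ hf hg =>
      simp only [ContinuousMap.add_apply, integral_add (hint f _) (hint g _)]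
      exact hf.add hg
    | smul c f _ hf =>
      simp only [ContinuousMap.smul_apply, integral_smul]
      exact hf.const_smul c
  have hf : f ∈ closure (Submodule.span ℂ (Set.range (mFourier (d := ι))) : Set _) := by
    rw [← Submodule.topologicalClosure_coe, span_mFourier_closure_eq_top]; trivial
  rw [Metric.tendsto_nhds]
  intro ε hε
  obtain ⟨g, hg, hfg⟩ := Metric.mem_closure_iff.1 hf (ε / 3) (by positivity)
  have hclose : ∀ ν : ProbabilityMeasure (ι → ℝ),
      dist (∫ x, f (proj x) ∂(ν : Measure (ι → ℝ))) (∫ x, g (proj x) ∂(ν : Measure (ι → ℝ)))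
        < ε / 3 := fun ν => by
    rw [dist_eq_norm, ← integral_sub (hint f ν) (hint g ν)]
    refine lt_of_le_of_lt (norm_integral_le_of_norm_le_const (C := ‖f - g‖)
      (ae_of_all _ fun x => (f - g).norm_coe_le_norm (proj x))) ?_
    simpa [← dist_eq_norm] using hfg
  filter_upwards [Metric.tendsto_nhds.1 (hspan g hg) (ε / 3) (by positivity)] with p hp
  have h1 := hclose (μ p)
  have h2 := hclose (cubeMeasure ι)
  rw [dist_comm] at h2
  linarith [dist_triangle4 (∫ x, f (proj x) ∂(μ p : Measure (ι → ℝ)))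
    (∫ x, g (proj x) ∂(μ p : Measure (ι → ℝ)))
    (∫ x, g (proj x) ∂(cubeMeasure ι : Measure (ι → ℝ)))
    (∫ x, f (proj x) ∂(cubeMeasure ι : Measure (ι → ℝ)))]

/-- **Weyl's criterion** for probability measures carried by the half-open unit cube. -/
theorem tendsto_cubeMeasure {P : Type*} {l : Filter P} [l.IsCountablyGenerated]
    {μ : P → ProbabilityMeasure (ι → ℝ)}
    (hμ : ∀ p, ∀ᵐ x ∂(μ p : Measure (ι → ℝ)), ∀ i, x i ∈ Set.Ico 0 1)
    (h : ∀ k : ι → ℤ, k ≠ 0 →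
      Tendsto (fun p => ∫ x, mFourier k (proj x) ∂(μ p : Measure (ι → ℝ))) l (𝓝 0)) :
    Tendsto μ l (𝓝 (cubeMeasure ι)) := by
  have hmeas : ∀ ν : ProbabilityMeasure (ι → ℝ), AEMeasurable proj (ν : Measure (ι → ℝ)) :=
    fun ν => continuous_proj.measurable.aemeasurable
  have htorus : Tendsto (fun p => (μ p).map (hmeas _)) l
      (𝓝 ((cubeMeasure ι).map (hmeas _))) := by
    rw [ProbabilityMeasure.tendsto_iff_forall_integral_rclike_tendsto ℂ]
    intro f
    have := tendsto_integral_comp_proj h f.toContinuousMap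
    simpa [integral_map (hmeas _) f.continuous.aestronglyMeasurable] using this
  -- Convergence on the torus is lifted to `ℝ^ι` by the open-set form of the portmanteau theorem.
  -- Shrinking `G` to the open cube loses only null faces for the limit measure, and `proj` maps the
  -- result to an open set.
  refine tendsto_of_forall_isOpen_le_liminf' fun G hG => ?_
  set W : Set (ι → ℝ) := G ∩ Set.univ.pi fun _ => Set.Ioo 0 1 with hW
  have hWo : IsOpen W := hG.inter (isOpen_set_pi Set.finite_univ fun _ _ => isOpen_Ioo)
  have hπW : IsOpen (proj '' W) := isOpenMap_proj _ hWo
  have key := ProbabilityMeasure.le_liminf_measure_open_of_tendsto htorus hπW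
  simp only [ProbabilityMeasure.toMeasure_map,
    Measure.map_apply_of_aemeasurable (hmeas _) hπW.measurableSet] at key
  refine le_trans (le_trans ?_ key) (liminf_le_liminf (Eventually.of_forall fun p => ?_))
  · have : (cubeMeasure ι : Measure (ι → ℝ)) G = (cubeMeasure ι : Measure (ι → ℝ)) W := by
      rw [coe_cubeMeasure, Measure.restrict_apply hG.measurableSet,
        Measure.restrict_apply hWo.measurableSet]
      refine measure_congr ?_
      have : (Set.univ.pi fun _ : ι => Set.Ioo (0 : ℝ) 1) =ᵐ[volume]
          Set.univ.pi fun _ : ι => Set.Ioc (0 : ℝ) 1 := by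
        rw [volume_pi]; exact Measure.univ_pi_Ioo_ae_eq_Icc.trans Measure.univ_pi_Ioc_ae_eq_Icc.symm
      have h2 := ((ae_eq_refl G).inter this).inter
        (ae_eq_refl (μ := volume) (Set.univ.pi fun _ : ι => Set.Ioc (0 : ℝ) 1))
      rw [hW]
      refine EventuallyEq.trans ?_ h2.symm
      rw [Set.inter_assoc, Set.inter_self]
      exact EventuallyEq.rfl
    rw [this]
    exact measure_mono (Set.subset_preimage_image _ _)
  · refine measure_mono_ae ?_
    filter_upwards [hμ p] with x hx
    rintro ⟨y, ⟨hyG, hy⟩, hyx⟩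
    -- Coordinates in `(0, 1)` and `[0, 1)` differ by less than 1, so no point of the support
    -- outside `G` is picked up.
    have : y = x := eq_of_proj_eq hyx fun i => by
      have h1 := hy i trivial
      have h2 := hx i
      rw [abs_lt]
      constructor <;> linarith [h1.1, h1.2, h2.1, h2.2]
    exact this ▸ hyG

end UnitAddTorus

/-! ### Null boundary from rectangle approximation -/

theorem IsRectangle.convex {ι : Type*} {B : Set (ι → ℝ)} (hB : IsRectangle B) : Convex ℝ B := by
  obtain ⟨I, hI, rfl⟩ := hB
  exact convex_pi fun i _ => (hI i).1.convex

/-- A set that is approximated by rectangles from inside and outside has null boundary. -/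
theorem HasRectangleApproximation.volume_frontier {ι : Type*} [Fintype ι] {R : Set (ι → ℝ)}
    (hR : HasRectangleApproximation R) : volume (frontier R) = 0 := by
  refine le_antisymm (ENNReal.le_of_forall_pos_le_add fun ε hε _ => ?_) zero_le
  obtain ⟨k, l, B, C, hB, hC, hBR, hRC, hB', hC'⟩ := hR (ε / 2) (by positivity)
  -- A boundary point of `R` lies in the closure of some `C j` and in the interior of no `B i`. So
  -- it lies in one of the two small differences or on the boundary of a rectangle, which is null by
  -- convexity.
  have hsub : frontier R ⊆ ((⋃ j, C j) \ R ∪ (R \ ⋃ i, B i)) ∪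
      ((⋃ j, frontier (C j)) ∪ ⋃ i, frontier (B i)) := by
    intro x hx
    have h1 : x ∈ ⋃ j, closure (C j) := by
      rw [← closure_iUnion_of_finite]
      exact closure_mono hRC hx.1
    have h2 : x ∉ ⋃ i, interior (B i) := fun h =>
      hx.2 (interior_mono hBR (by
        obtain ⟨i, hi⟩ := Set.mem_iUnion.1 h
        exact interior_mono (Set.subset_iUnion B i) hi))
    simp only [Set.mem_iUnion, not_exists, closure_eq_self_union_frontier, Set.mem_union,
      Set.mem_sdiff] at h1 h2 ⊢
    obtain ⟨j, hj | hj⟩ := h1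
    · by_cases hxB : ∃ i, x ∈ B i
      · obtain ⟨i, hi⟩ := hxB
        exact Or.inr (Or.inr ⟨i, subset_closure hi, h2 i⟩)
      · by_cases hxR : x ∈ R
        · exact Or.inl (Or.inr ⟨hxR, fun i hi => hxB ⟨i, hi⟩⟩)
        · exact Or.inl (Or.inl ⟨⟨j, hj⟩, hxR⟩)
    · exact Or.inr (Or.inl ⟨j, hj⟩)
  have hnull : volume ((⋃ j, frontier (C j)) ∪ ⋃ i, frontier (B i)) = 0 :=
    measure_union_null
      (measure_iUnion_null fun j => (hC.1 j).convex.addHaar_frontier volume)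
      (measure_iUnion_null fun i => (hB.1 i).convex.addHaar_frontier volume)
  calc volume (frontier R) ≤ volume ((⋃ j, C j) \ R) + volume (R \ ⋃ i, B i) + 0 := by
        refine (measure_mono hsub).trans ((measure_union_le _ _).trans ?_)
        rw [hnull]
        gcongr
        exact measure_union_le _ _
    _ ≤ ENNReal.ofReal (ε / 2) + ENNReal.ofReal (ε / 2) + 0 := by gcongr
    _ = 0 + ε := by
        rw [← ENNReal.ofReal_add (by positivity) (by positivity), add_halves]; simp

/-! ### Equidistribution of the points of `SL_n(𝔽_p)` -/

section SpecialLinear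

variable {n p : ℕ}

theorem slPoint_mem_Ico [NeZero p] (A : Matrix.SpecialLinearGroup (Fin n) (ZMod p))
    (i : PairIndex n) : slPoint n p A i ∈ Set.Ico (0 : ℝ) 1 := by
  have hp : (0 : ℝ) < p := by exact_mod_cast NeZero.pos p
  have h : ∀ a : ZMod p, (a.val : ℝ) / p ∈ Set.Ico (0 : ℝ) 1 := fun a =>
    ⟨by positivity, (div_lt_one hp).2 (by exact_mod_cast a.val_lt)⟩
  rcases i with ⟨i, j | j⟩ <;> exact h _

/-- Lets the count of points in the theorem be read as a count of matrices. -/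
theorem slPoint_injective [NeZero p] : Function.Injective (slPoint n p) := by
  intro A B h
  have hp : (p : ℝ) ≠ 0 := by exact_mod_cast NeZero.ne p
  ext i j
  have := congr_fun h (i, Sum.inl j)
  simp only [slPoint] at this
  exact ZMod.val_injective p (by exact_mod_cast (div_left_inj' hp).1 this)

theorem fourier_val_div [NeZero p] (k : ℤ) (a : ZMod p) :
    fourier k (((a.val : ℝ) / p : ℝ) : UnitAddCircle) = ZMod.stdAddChar ((k : ZMod p) * a) := by
  rw [← ZMod.toAddCircle_apply, fourier_apply, ← map_zsmul, zsmul_eq_mul]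
  rfl

/-- The matrix of a row-indexed family of integers, reduced mod `p` and transposed. -/
def reducedTranspose (p : ℕ) (k : Fin n → Fin n → ℤ) : Matrix (Fin n) (Fin n) (ZMod p) :=
  fun j i => k i j

theorem trace_reducedTranspose_mul (k : Fin n → Fin n → ℤ) (A : Matrix (Fin n) (Fin n) (ZMod p)) :
    (reducedTranspose p k * A).trace = ∑ i, ∑ j, (k i j : ZMod p) * A i j := by
  simp only [Matrix.trace, Matrix.diag, Matrix.mul_apply, reducedTranspose]
  exact Finset.sum_comm

theorem AddChar.map_sum_eq_prod {ι A M : Type*} [AddCommMonoid A] [CommMonoid M]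
    (ψ : AddChar A M) (f : ι → A) (s : Finset ι) : ψ (∑ i ∈ s, f i) = ∏ i ∈ s, ψ (f i) := by
  classical
  induction s using Finset.induction_on with
  | empty => simp
  | insert i s hi ih =>
    rw [Finset.sum_insert hi, Finset.prod_insert hi, AddChar.map_add_eq_mul, ih]

theorem mFourier_proj_slPoint [NeZero p] (k : PairIndex n → ℤ)
    (A : Matrix.SpecialLinearGroup (Fin n) (ZMod p)) :
    UnitAddTorus.mFourier k (UnitAddTorus.proj (slPoint n p A)) =
      ZMod.stdAddChar ((reducedTranspose p (fun i j => k (i, Sum.inl j)) * A.1).trace +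
        (reducedTranspose p (fun i j => k (i, Sum.inr j)) * A⁻¹.1).trace) := by
  change ∏ x, fourier (k x) ((slPoint n p A x : ℝ) : UnitAddCircle) = _
  simp only [trace_reducedTranspose_mul, ← Finset.sum_add_distrib, Fintype.prod_prod_type,
    Fintype.prod_sum_type, slPoint, fourier_val_div, AddChar.map_add_eq_mul,
    AddChar.map_sum_eq_prod, Finset.prod_mul_distrib]

theorem reducedTranspose_ne_zero {k : Fin n → Fin n → ℤ} {i j : Fin n} (hk : k i j ≠ 0)
    (hp : (k i j).natAbs < p) : reducedTranspose p k ≠ 0 := fun h => by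
  have : (k i j : ZMod p) = 0 := congr_fun (congr_fun h j) i
  rw [ZMod.intCast_zmod_eq_zero_iff_dvd] at this
  exact hk (Int.eq_zero_of_dvd_of_natAbs_lt_natAbs this (by simpa using hp))

theorem norm_sum_mFourier_proj_slPoint_le (hn : 3 ≤ n) (hp : p.Prime) {k : PairIndex n → ℤ}
    {x : PairIndex n} (hk : k x ≠ 0) (hkp : (k x).natAbs < p) :
    haveI : NeZero p := ⟨hp.ne_zero⟩
    ‖∑ A : Matrix.SpecialLinearGroup (Fin n) (ZMod p),
        UnitAddTorus.mFourier k (UnitAddTorus.proj (slPoint n p A))‖ ≤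
      (n + 1) * Fintype.card (Matrix.SpecialLinearGroup (Fin n) (ZMod p)) / p := by
  have : Fact p.Prime := ⟨hp⟩
  have hp0 : (0 : ℝ) < p := by exact_mod_cast hp.pos
  simp only [mFourier_proj_slPoint]
  rw [le_div_iff₀ hp0]
  have := Matrix.SpecialLinearGroup.norm_sum_addChar_trace_mul_card_le (n := Fin n) (F := ZMod p)
    (by simpa using hn) (ZMod.isPrimitive_stdAddChar p)
    (U := reducedTranspose p fun i j => k (i, Sum.inl j))
    (V := reducedTranspose p fun i j => k (i, Sum.inr j)) (by
      rcases x with ⟨i, j | j⟩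
      · exact Or.inl (reducedTranspose_ne_zero (i := i) (j := j) hk hkp)
      · exact Or.inr (reducedTranspose_ne_zero (i := i) (j := j) hk hkp))
  simpa only [ZMod.card, Fintype.card_fin] using this

/-- The uniform probability measure on the points attached to `SL_n(𝔽_p)`. -/
noncomputable def slMeasure (n p : ℕ) [NeZero p] : ProbabilityMeasure (PairIndex n → ℝ) :=
  ⟨(Fintype.card (Matrix.SpecialLinearGroup (Fin n) (ZMod p)) : ENNReal)⁻¹ •
      ∑ A : Matrix.SpecialLinearGroup (Fin n) (ZMod p), Measure.dirac (slPoint n p A),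
    ⟨by
      simp only [Measure.smul_apply, Measure.finsetSum_apply, measure_univ, Finset.sum_const,
        Finset.card_univ, nsmul_eq_mul, mul_one, smul_eq_mul]
      exact ENNReal.inv_mul_cancel (by simp [Fintype.card_ne_zero]) (by simp)⟩⟩

theorem coe_slMeasure [NeZero p] : (slMeasure n p : Measure (PairIndex n → ℝ)) =
    (Fintype.card (Matrix.SpecialLinearGroup (Fin n) (ZMod p)) : ENNReal)⁻¹ •
      ∑ A : Matrix.SpecialLinearGroup (Fin n) (ZMod p), Measure.dirac (slPoint n p A) := rfl

theorem slMeasure_toReal [NeZero p] (R : Set (PairIndex n → ℝ)) :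
    ((slMeasure n p : Measure (PairIndex n → ℝ)) R).toReal =
      ((Set.range (slPoint n p) ∩ R).ncard : ℝ) /
        (Nat.card (Matrix.SpecialLinearGroup (Fin n) (ZMod p)) : ℝ) := by
  classical
  have h : Set.range (slPoint n p) ∩ R =
      ((Finset.univ.filter fun A => slPoint n p A ∈ R).image (slPoint n p) : Finset _) := by
    ext x
    simp only [Set.mem_inter_iff, Set.mem_range, Finset.coe_image, Finset.coe_filter,
      Finset.mem_univ, true_and, Set.mem_image, Set.mem_ofPred_eq]
    constructor
    · rintro ⟨⟨A, rfl⟩, hA⟩; exact ⟨A, hA, rfl⟩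
    · rintro ⟨A, hA, rfl⟩; exact ⟨⟨A, rfl⟩, hA⟩
  rw [h, Set.ncard_coe_finset, Finset.card_image_of_injective _ slPoint_injective, coe_slMeasure]
  simp only [Measure.smul_apply, Measure.finsetSum_apply, Measure.dirac_apply, Set.indicator_apply,
    Pi.one_apply, smul_eq_mul, ENNReal.toReal_mul, ENNReal.toReal_inv, ENNReal.toReal_natCast,
    Nat.card_eq_fintype_card, Finset.sum_boole]
  rw [div_eq_inv_mul]

theorem integral_slMeasure [NeZero p] (f : (PairIndex n → ℝ) → ℂ) :
    ∫ x, f x ∂(slMeasure n p : Measure (PairIndex n → ℝ)) =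
      (Fintype.card (Matrix.SpecialLinearGroup (Fin n) (ZMod p)) : ℝ)⁻¹ •
        ∑ A : Matrix.SpecialLinearGroup (Fin n) (ZMod p), f (slPoint n p A) := by
  rw [coe_slMeasure, integral_smul_measure, integral_finsetSum_measure fun A _ =>
    integrable_dirac enorm_lt_top]
  simp only [integral_dirac, ENNReal.toReal_inv, ENNReal.toReal_natCast]

theorem ae_slMeasure_mem_Ico [NeZero p] :
    ∀ᵐ x ∂(slMeasure n p : Measure (PairIndex n → ℝ)), ∀ i, x i ∈ Set.Ico (0 : ℝ) 1 := by
  rw [ae_iff, coe_slMeasure]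
  rw [Measure.smul_apply, Measure.finsetSum_apply, smul_eq_mul]
  refine mul_eq_zero_of_right _ ?_
  exact Finset.sum_eq_zero fun A _ => by
    rw [Measure.dirac_apply, Set.indicator_of_notMem]
    exact fun h => h (slPoint_mem_Ico A)

/-- Equidistribution of the pairs `(A, A⁻¹)`, as weak convergence of measures. -/
theorem tendsto_slMeasure (hn : 3 ≤ n) :
    Tendsto (fun p : {p : ℕ // p.Prime} => haveI : NeZero (p : ℕ) := ⟨p.2.ne_zero⟩; slMeasure n p)
      (comap (fun p : {p : ℕ // p.Prime} => (p : ℕ)) atTop) (𝓝 (UnitAddTorus.cubeMeasure _)) := by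
  have : ∀ p : {p : ℕ // p.Prime}, NeZero (p : ℕ) := fun p => ⟨p.2.ne_zero⟩
  refine UnitAddTorus.tendsto_cubeMeasure (fun p => ae_slMeasure_mem_Ico) fun k hk => ?_
  obtain ⟨x, hx⟩ := Function.ne_iff.1 hk
  have hlim : Tendsto (fun p : ℕ => (n + 1 : ℝ) / p) atTop (𝓝 0) :=
    tendsto_const_div_atTop_nhds_zero_nat _
  refine squeeze_zero_norm' ?_ (hlim.comp tendsto_comap)
  -- Once `p` exceeds `|k x|`, the entry `k x` stays nonzero mod `p`.
  filter_upwards [preimage_mem_comap (eventually_gt_atTop (k x).natAbs)] with p hp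
  have hc : (0 : ℝ) < Fintype.card (Matrix.SpecialLinearGroup (Fin n) (ZMod p)) := by
    exact_mod_cast Fintype.card_pos
  rw [integral_slMeasure, norm_smul, norm_inv, Real.norm_of_nonneg hc.le, inv_mul_le_iff₀ hc]
  refine (norm_sum_mFourier_proj_slPoint_le hn p.2 hx hp).trans_eq ?_
  simp only [Function.comp_apply]
  ring

end SpecialLinear

/-! ### Conclusion -/

theorem mainTheorem6 (n : ℕ) (hn : 3 ≤ n) (R : Set (PairIndex n → ℝ))
    (hR : R ⊆ Set.Icc 0 1) (hmeas : NullMeasurableSet R volume)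
    (happrox : HasRectangleApproximation R) :
    Tendsto
      (fun p : ℕ => ((Set.range (slPoint n p) ∩ R).ncard : ℝ) /
        (Nat.card (Matrix.SpecialLinearGroup (Fin n) (ZMod p)) : ℝ))
      (atTop ⊓ 𝓟 {p : ℕ | p.Prime}) (𝓝 (volume R).toReal) := by
  -- The measures `slMeasure n p` need `p ≠ 0`, so the limit is moved to the subtype of primes.
  have hfilter : atTop ⊓ 𝓟 {p : ℕ | p.Prime} =
      map (fun p : {p : ℕ // p.Prime} => (p : ℕ)) (comap (fun p : {p : ℕ // p.Prime} => (p : ℕ)) atTop) := by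
    rw [map_comap]
    congr 2
    exact Subtype.range_coe.symm
  rw [hfilter, tendsto_map'_iff]
  have hfrontier : (UnitAddTorus.cubeMeasure (PairIndex n) : Measure _) (frontier R) = 0 := by
    rw [UnitAddTorus.coe_cubeMeasure]
    exact le_antisymm ((Measure.restrict_apply_le _ _).trans happrox.volume_frontier.le) zero_le
  have hvol : (UnitAddTorus.cubeMeasure (PairIndex n) : Measure _) R = volume R := by
    rw [UnitAddTorus.coe_cubeMeasure, Measure.restrict_apply'
      (MeasurableSet.univ_pi fun _ => measurableSet_Ioc)]
    have : (Set.univ.pi fun _ : PairIndex n => Set.Ioc (0 : ℝ) 1) =ᵐ[volume] Set.Icc 0 1 := by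
      rw [volume_pi]; exact Measure.univ_pi_Ioc_ae_eq_Icc
    rw [measure_congr ((ae_eq_refl R).inter this), Set.inter_eq_left.2 hR]
  have key := ProbabilityMeasure.tendsto_measure_of_null_frontier_of_tendsto'
    (tendsto_slMeasure hn) hfrontier
  rw [hvol] at key
  have hfin : volume R ≠ ⊤ := hvol ▸ measure_ne_top _ _
  refine ((ENNReal.tendsto_toReal hfin).comp key).congr fun p => ?_
  have : NeZero (p : ℕ) := ⟨p.2.ne_zero⟩
  exact slMeasure_toReal R
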